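/- (i) Let $V$ be a finite-dimensional real vector space and let $\nu$ be a positive definite quadratic form on $V$. Then $x\mapsto|\nu(x)|^{1/2}$ is a norm on $V$. (ii) Let $k$ be a non-archimedean local field, that is, a locally compact field whose topology is given by a non-trivial non-archimedean absolute value $|\cdot|$ (of any characteristic). Let $V$ be a vector space over $k$ of finite dimension $m$, and let $r\ge 1$ be an integer with $r^2\ge m$. Then there is a function $\nu\colon V\to k$ given by a homogeneous polynomial of degree $r$ in the coordinates of $V$ such that (a) $\nu$ is definite, i.e. for $x\in V$, $\nu(x)=0$ if and only if $x=0$; (b) $N(x)=|\nu(x)|^{1/r}$ is a non-archimedean norm on $V$, i.e. a norm ($N(x)\ge 0$, $N(x)=0$ if and only if $x=0$, $N(ax)=|a|N(x)$ for $a\in k$) with $N(x+y)\le\max(N(x),N(y))$; (c) $\nu$ is the restriction to $V$ of the reduced norm of a central division algebra of dimension $r^2$: there are a division algebra $D$ with centre $k$ and $\dim_k D=r^2$ and an injective $k$-linear map $\iota\colon V\to D$ with $\nu=\mathrm{Nrd}_D\circ\iota$. Here $\mathrm{Nrd}_D\colon D\to k$ is the reduced norm, characterized by $\mathrm{Nrd}_D(a)=\det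 F(1\otimes a)$ for every extension field $K$ of $k$ and every isomorphism of $K$-algebras $F\colon K\otimes_k D\to M_r(K)$ (such $K$ and $F$ exist). -/

import Mathlib

open scoped TensorProduct

universe u v

/-- `N` is a norm on the vector space `V` over the normed field `k`. -/
structure IsVectorNorm (k : Type u) {V : Type v} [NormedField k] [AddCommGroup V] [Module k V]
    (N : V → ℝ) : Prop where
  nonneg : ∀ x, 0 ≤ N x
  eq_zero_iff : ∀ x, N x = 0 ↔ x = 0
  smul : ∀ (a : k) (x : V), N (a • x) = ‖a‖ * N x
  add_le : ∀ x y, N (x + y) ≤ N x + N y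

/-- `N` is a non-archimedean norm on the vector space `V` over the normed field `k`. -/
structure IsNonarchVectorNorm (k : Type u) {V : Type v} [NormedField k] [AddCommGroup V]
    [Module k V] (N : V → ℝ) : Prop extends IsVectorNorm k N where
  add_le_max : ∀ x y, N (x + y) ≤ max (N x) (N y)

/-- `f : V → k` is (the function given by) a homogeneous polynomial of degree `d` on the
finite-dimensional space `V`: in the coordinates of a basis of `V` it is given by a homogeneous
polynomial of degree `d`. A linear change of coordinates preserves such polynomials, so the
choice of the basis is immaterial. -/
def IsHomogeneousPolynomialFunction (k : Type u) {V : Type v} [Field k] [AddCommGroup V]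
    [Module k V] (d : ℕ) (f : V → k) : Prop :=
  ∃ (b : Module.Basis (Fin (Module.finrank k V)) k V)
    (P : MvPolynomial (Fin (Module.finrank k V)) k),
    P.IsHomogeneous d ∧ ∀ x, f x = MvPolynomial.eval (fun i => b.repr x i) P

/-- `ν : D → k` is the reduced norm of the `k`-algebra `D` of degree `r` (i.e. of dimension `r ^ 2`
over its centre `k`): `D` is split by some extension field of `k`, and for every extension field
`K` and every isomorphism `F` of `K ⊗ D` with the algebra of `r × r` matrices over `K`, one has
`ν a = det (F (1 ⊗ a))`. -/
structure IsReducedNorm (k : Type u) (D : Type u) [Field k] [Ring D] [Algebra k D] (r : ℕ)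
    (ν : D → k) : Prop where
  exists_splitting : ∃ (K : Type u) (_ : Field K) (_ : Algebra k K),
    Nonempty (K ⊗[k] D ≃ₐ[K] Matrix (Fin r) (Fin r) K)
  eq_det : ∀ (K : Type u) [Field K] [Algebra k K]
    (F : K ⊗[k] D ≃ₐ[K] Matrix (Fin r) (Fin r) K) (a : D),
    algebraMap k K (ν a) = (F (1 ⊗ₜ[k] a)).det

/-!
For (i), `√Q` is a norm by the Cauchy–Schwarz inequality for the polar form of `Q`.

For (ii), let `q` be the cardinality of the residue field of `k`. Adjoining the roots of unity of
order `q ^ r - 1` gives an extension `L` of degree `r` with the same value group as `k`, cyclic with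
generator `σ` because its Galois group embeds in that of the residue fields. The matrices over `L`
commuting with the semilinear map `x ↦ U σ(x)`, where `U` is the cyclic shift weighted by a
uniformizer `π`, form the cyclic algebra `D = (L / k, σ, π)`. With `ρ = ‖π‖ ^ (1 / r)`, a matrix of
`D` has, after rescaling its rows and columns by powers of `ρ`, entries whose absolute values form a
circulant matrix with first row `ρ ^ j ‖x j‖`. Nonzero values `ρ ^ j ‖x j‖` are distinct, so a
single generalized diagonal dominates the determinant, and `|Nrd x| = (max ρ ^ j ‖x j‖) ^ r`, which
vanishes only at `0` and is ultrametric in `x`. Finally `V` embeds linearly in `D`.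
-/

theorem sqrt_map_add_le_of_posDef {V : Type*} [AddCommGroup V] [Module ℝ V]
    {Q : QuadraticForm ℝ V} (hQ : Q.PosDef) (x y : V) : √(Q (x + y)) ≤ √(Q x) + √(Q y) := by
  have hself : ∀ z, QuadraticMap.associated (R := ℝ) Q z z = Q z :=
    QuadraticMap.associated_eq_self_apply ℝ Q
  have hsq : QuadraticMap.associated (R := ℝ) Q x y ^ 2 ≤ Q x * Q y := by
    simpa only [hself] using LinearMap.BilinForm.apply_sq_le_of_symm
      (QuadraticMap.associated (R := ℝ) Q) (fun z => by rw [hself]; exact hQ.nonneg z)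
      ⟨QuadraticMap.associated_isSymm ℝ Q⟩ x y
  have hpolar : Q (x + y) = Q x + Q y + 2 * QuadraticMap.associated (R := ℝ) Q x y := by
    rw [QuadraticMap.associated_apply]
    simp
  have hcauchy : QuadraticMap.associated (R := ℝ) Q x y ≤ √(Q x) * √(Q y) := by
    rw [← Real.sqrt_mul (hQ.nonneg x)]
    exact Real.le_sqrt_of_sq_le hsq
  refine Real.sqrt_le_iff.mpr ⟨by positivity, ?_⟩
  rw [hpolar, add_sq, Real.sq_sqrt (hQ.nonneg x), Real.sq_sqrt (hQ.nonneg y)]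
  linarith

theorem isVectorNorm_of_posDef {V : Type*} [AddCommGroup V] [Module ℝ V]
    {Q : QuadraticForm ℝ V} (hQ : Q.PosDef) :
    IsVectorNorm ℝ (fun x : V => |Q x| ^ ((1 : ℝ) / 2)) := by
  have hsqrt : (fun x : V => |Q x| ^ ((1 : ℝ) / 2)) = fun x => √(Q x) := by
    ext x
    rw [abs_of_nonneg (hQ.nonneg x), Real.sqrt_eq_rpow]
  rw [hsqrt]
  refine ⟨fun x => Real.sqrt_nonneg _, fun x => ?_, fun a x => ?_, sqrt_map_add_le_of_posDef hQ⟩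
  · rw [Real.sqrt_eq_zero (hQ.nonneg x)]
    exact hQ.anisotropic.eq_zero_iff
  · rw [QuadraticMap.map_smul, smul_eq_mul, Real.sqrt_mul (mul_self_nonneg a),
      Real.sqrt_mul_self_eq_abs, Real.norm_eq_abs]

/-! ### Splittings of central division algebras -/

section Splitting

variable {k D Ω B : Type*} [Field k] [DivisionRing D] [Algebra k D] [Field Ω] [Algebra k Ω]
  [Ring B] [Algebra Ω B] [Algebra k B] [IsScalarTower k Ω B]

/-- The extension of scalars `ω ⊗ d ↦ ω • f d` of a `k`-algebra homomorphism `f` into an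
`Ω`-algebra. -/
noncomputable def scalarExtension (f : D →ₐ[k] B) : Ω ⊗[k] D →ₐ[Ω] B :=
  Algebra.TensorProduct.lift (Algebra.ofId Ω B) f fun a b => by
    rw [Algebra.ofId_apply]
    exact Algebra.commute_algebraMap_left a (f b)

theorem scalarExtension_tmul (f : D →ₐ[k] B) (ω : Ω) (a : D) :
    scalarExtension f (ω ⊗ₜ[k] a) = ω • f a := by
  rw [scalarExtension, Algebra.TensorProduct.lift_tmul, Algebra.ofId_apply, Algebra.smul_def]

section Central

variable [Algebra.IsCentral k D] [Nontrivial B]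

theorem exists_mul_ne_mul_of_add_sum_smul_eq_zero (f : D →ₐ[k] B) {ι : Type*} {ω : ι → Ω}
    (hω : LinearIndependent k ω) {s : Finset ι} {j : ι} (hj : j ∉ s) {e : ι → D}
    (he : ω j • (1 : B) + ∑ i ∈ s, ω i • f (e i) = 0) : ∃ a, ∃ i ∈ s, a * e i ≠ e i * a := by
  classical
  by_contra! hcomm
  have hscalar : ∀ i ∈ s, ∃ c : k, algebraMap k D c = e i := fun i hi => by
    have : e i ∈ Subalgebra.center k D := Subalgebra.mem_center_iff.mpr fun a => hcomm a i hi
    rwa [Algebra.IsCentral.center_eq_bot, Algebra.mem_bot] at this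
  choose! c hc using hscalar
  have hrel : ω j + ∑ i ∈ s, c i • ω i = 0 := by
    refine (algebraMap Ω B).injective ?_
    rw [map_zero, ← he, map_add, map_sum, Algebra.algebraMap_eq_smul_one (ω j)]
    refine congrArg _ (Finset.sum_congr rfl fun i hi => ?_)
    rw [← hc i hi, AlgHom.commutes, IsScalarTower.algebraMap_apply k Ω B, Algebra.smul_def,
      Algebra.smul_def, ← map_mul, mul_comm]
  refine hω.notMem_span_image (s := (s : Set ι)) (x := j) (by simpa using hj) ?_
  rw [eq_neg_of_add_eq_zero_left hrel]
  exact neg_mem <| sum_mem fun i hi =>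
    Submodule.smul_mem _ _ (Submodule.subset_span (Set.mem_image_of_mem ω hi))

/-- A shortest nontrivial relation, normalised to have one coefficient `1`, is shortened by taking
commutators with `a : D`; so its coefficients are central, against the independence of `ω`. -/
theorem eq_zero_of_sum_smul_map_eq_zero (f : D →ₐ[k] B) {ι : Type*} {ω : ι → Ω}
    (hω : LinearIndependent k ω) (s : Finset ι) (d : ι → D)
    (hd : ∑ i ∈ s, ω i • f (d i) = 0) : ∀ i ∈ s, d i = 0 := by
  classical
  induction s using Finset.induction_on generalizing d with
  | empty => simp
  | insert j s hj ih =>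
    rw [Finset.sum_insert hj] at hd
    suffices hdj : d j = 0 by
      rw [Finset.forall_mem_insert]
      exact ⟨hdj, ih d (by simpa [hdj] using hd)⟩
    by_contra hdj
    have hnormalised : ω j • (1 : B) + ∑ i ∈ s, ω i • f ((d j)⁻¹ * d i) = 0 := by
      simpa [mul_add, Finset.mul_sum, ← map_mul, inv_mul_cancel₀ hdj]
        using congrArg (f (d j)⁻¹ * ·) hd
    obtain ⟨a, i, hi, hai⟩ := exists_mul_ne_mul_of_add_sum_smul_eq_zero f hω hj hnormalised
    refine hai (sub_eq_zero.mp (ih (fun i => a * ((d j)⁻¹ * d i) - (d j)⁻¹ * d i * a) ?_ i hi))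
    calc ∑ i ∈ s, ω i • f (a * ((d j)⁻¹ * d i) - (d j)⁻¹ * d i * a)
        = f a * (∑ i ∈ s, ω i • f ((d j)⁻¹ * d i))
          - (∑ i ∈ s, ω i • f ((d j)⁻¹ * d i)) * f a := by
          simp only [Finset.mul_sum, Finset.sum_mul, ← Finset.sum_sub_distrib, map_sub, map_mul,
            smul_sub, mul_smul_comm, smul_mul_assoc]
      _ = 0 := by
          rw [eq_neg_of_add_eq_zero_right hnormalised, mul_neg, neg_mul, mul_smul_comm,
            smul_mul_assoc, mul_one, one_mul, sub_self]

theorem scalarExtension_injective (f : D →ₐ[k] B) :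
    Function.Injective (scalarExtension (Ω := Ω) f) := by
  classical
  rw [injective_iff_map_eq_zero]
  intro z hz
  let b := Module.Basis.ofVectorSpace k Ω
  obtain ⟨d, rfl⟩ := (TensorProduct.equivFinsuppOfBasisLeft b).symm.surjective z
  rw [TensorProduct.equivFinsuppOfBasisLeft_symm_apply, Finsupp.sum, map_sum] at hz
  simp only [scalarExtension_tmul] at hz
  have hd : d = 0 := Finsupp.ext fun i => by
    by_contra hi
    exact hi (eq_zero_of_sum_smul_map_eq_zero f b.linearIndependent d.support d hz i
      (Finsupp.mem_support_iff.mpr hi))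
  rw [hd, map_zero]

end Central

variable [Algebra.IsCentral k D] {r : ℕ}

theorem scalarExtension_bijective (hD : Module.finrank k D = r ^ 2) (hr : 0 < r)
    (f : D →ₐ[k] Matrix (Fin r) (Fin r) Ω) :
    Function.Bijective (scalarExtension (Ω := Ω) f) := by
  have : NeZero r := ⟨hr.ne'⟩
  have : FiniteDimensional k D := .of_finrank_pos (by rw [hD]; positivity)
  have hinj := scalarExtension_injective (Ω := Ω) f
  refine ⟨hinj, (LinearMap.injective_iff_surjective_of_finrank_eq_finrank
    (f := (scalarExtension (Ω := Ω) f).toLinearMap) ?_).mp hinj⟩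
  simp [hD, Module.finrank_matrix, sq]

theorem det_algHom_eq_det_algHom (hD : Module.finrank k D = r ^ 2) (hr : 0 < r)
    (f g : D →ₐ[k] Matrix (Fin r) (Fin r) Ω) (a : D) : (f a).det = (g a).det := by
  let F := AlgEquiv.ofBijective _ (scalarExtension_bijective hD hr f)
  let G := AlgEquiv.ofBijective _ (scalarExtension_bijective hD hr g)
  have hF : F (1 ⊗ₜ a) = f a := (scalarExtension_tmul f 1 a).trans (one_smul Ω (f a))
  have hG : G (1 ⊗ₜ a) = g a := (scalarExtension_tmul g 1 a).trans (one_smul Ω (g a))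
  rw [← hF, ← hG, ← Matrix.det_map (F.symm.trans G) (F _), AlgEquiv.trans_apply,
    AlgEquiv.symm_apply_apply]

end Splitting

theorem isReducedNorm_of_algHom {k D L : Type u} [Field k] [DivisionRing D] [Algebra k D]
    [Algebra.IsCentral k D] [Field L] [Algebra k L] [Algebra.IsAlgebraic k L] {r : ℕ}
    (hD : Module.finrank k D = r ^ 2) (hr : 0 < r) (f : D →ₐ[k] Matrix (Fin r) (Fin r) L)
    {ν : D → k} (hν : ∀ a, algebraMap k L (ν a) = (f a).det) : IsReducedNorm k D r ν where
  exists_splitting :=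
    ⟨L, _, _, ⟨AlgEquiv.ofBijective _ (scalarExtension_bijective hD hr f)⟩⟩
  eq_det K _ _ F a := by
    let i : L →ₐ[k] AlgebraicClosure K := IsAlgClosed.lift
    let j : K →ₐ[k] AlgebraicClosure K := IsScalarTower.toAlgHom k K (AlgebraicClosure K)
    let g : D →ₐ[k] Matrix (Fin r) (Fin r) K :=
      (F.toAlgHom.restrictScalars k).comp Algebra.TensorProduct.includeRight
    refine (j : K →+* AlgebraicClosure K).injective ?_
    calc j (algebraMap k K (ν a)) = i (algebraMap k L (ν a)) := by
          rw [AlgHom.commutes, AlgHom.commutes]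
      _ = i (f a).det := by rw [hν]
      _ = ((i.mapMatrix.comp f) a).det := AlgHom.map_det i (f a)
      _ = ((j.mapMatrix.comp g) a).det := det_algHom_eq_det_algHom hD hr _ _ a
      _ = j (g a).det := (AlgHom.map_det j (g a)).symm

/-! ### Homogeneous polynomial functions -/

theorem isHomogeneousPolynomialFunction_of_eval {k L V : Type*} [Field k] [Field L] [Algebra k L]
    [AddCommGroup V] [Module k V] {d : ℕ} (b : Module.Basis (Fin (Module.finrank k V)) k V)
    {P : MvPolynomial (Fin (Module.finrank k V)) L} (hP : P.IsHomogeneous d) {ν : V → k}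
    (hν : ∀ x, algebraMap k L (ν x) = P.eval fun i => algebraMap k L (b.repr x i)) :
    IsHomogeneousPolynomialFunction k d ν := by
  obtain ⟨p, hp⟩ := (Algebra.linearMap k L).exists_leftInverse_of_injective
    (LinearMap.ker_eq_bot.mpr (algebraMap k L).injective)
  have hp' : ∀ c, p (algebraMap k L c) = c := fun c => LinearMap.congr_fun hp c
  refine ⟨b, ∑ m ∈ P.support, MvPolynomial.monomial m (p (P.coeff m)), ?_, fun x => ?_⟩
  · refine MvPolynomial.IsHomogeneous.sum _ _ _ fun m hm => ?_
    refine MvPolynomial.isHomogeneous_monomial _ ?_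
    rw [Finsupp.degree_eq_weight_one]
    exact hP (MvPolynomial.mem_support_iff.mp hm)
  · rw [← hp' (ν x), hν, MvPolynomial.eval_eq, map_sum, map_sum]
    refine Finset.sum_congr rfl fun m _ => ?_
    simp_rw [← map_pow, ← map_prod]
    rw [mul_comm, ← Algebra.smul_def, map_smul, smul_eq_mul, mul_comm, MvPolynomial.eval_monomial]
    rfl

theorem eval_smul_of_isHomogeneous {σ R : Type*} [CommSemiring R] {P : MvPolynomial σ R} {d : ℕ}
    (hP : P.IsHomogeneous d) (a : R) (x : σ → R) : P.eval (a • x) = a ^ d * P.eval x := by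
  rw [MvPolynomial.eval_eq, MvPolynomial.eval_eq, Finset.mul_sum]
  refine Finset.sum_congr rfl fun m hm => ?_
  have hdeg : ∑ i ∈ m.support, m i = d := by
    rw [← hP (MvPolynomial.mem_support_iff.mp hm), Pi.one_def, ← Finsupp.degree_eq_weight_one]
    rfl
  simp only [Pi.smul_apply, smul_eq_mul, mul_pow, Finset.prod_mul_distrib,
    Finset.prod_pow_eq_pow_sum, hdeg]
  exact mul_left_comm _ _ _

theorem isHomogeneous_det {σ R n : Type*} [CommRing R] [Fintype n] [DecidableEq n]
    {A : Matrix n n (MvPolynomial σ R)} (hA : ∀ i j, (A i j).IsHomogeneous 1) :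
    A.det.IsHomogeneous (Fintype.card n) := by
  rw [Matrix.det_apply]
  refine MvPolynomial.IsHomogeneous.sum _ _ _ fun τ _ => ?_
  have hprod : (∏ i, A (τ i) i).IsHomogeneous (Fintype.card n) := by
    simpa using MvPolynomial.IsHomogeneous.prod Finset.univ (fun i => A (τ i) i) (fun _ => 1)
      fun i _ => hA (τ i) i
  rcases Int.units_eq_one_or (Equiv.Perm.sign τ) with h | h
  · simpa [h] using hprod
  · simpa [h] using hprod.neg

theorem isHomogeneousPolynomialFunction_of_det {k L V n : Type*} [Field k] [Field L] [Algebra k L]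
    [AddCommGroup V] [Module k V] [FiniteDimensional k V] [Fintype n] [DecidableEq n]
    (φ : V →ₗ[k] Matrix n n L) {ν : V → k} (hν : ∀ x, algebraMap k L (ν x) = (φ x).det) :
    IsHomogeneousPolynomialFunction k (Fintype.card n) ν := by
  let b := Module.finBasis k V
  let A : Matrix n n (MvPolynomial (Fin (Module.finrank k V)) L) :=
    Matrix.of fun s t => ∑ i, MvPolynomial.C (φ (b i) s t) * MvPolynomial.X i
  have hA : A.det.IsHomogeneous (Fintype.card n) := isHomogeneous_det fun s t =>
    MvPolynomial.IsHomogeneous.sum Finset.univ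
      (fun i => MvPolynomial.C (φ (b i) s t) * MvPolynomial.X i) 1
      fun i _ => MvPolynomial.isHomogeneous_C_mul_X _ i
  refine isHomogeneousPolynomialFunction_of_eval b hA fun x => ?_
  rw [hν, RingHom.map_det]
  congr 1
  ext s t
  have hx : φ x s t = ∑ i, b.repr x i • φ (b i) s t := by
    conv_lhs => rw [← b.sum_repr x, map_sum, Matrix.sum_apply]
    simp only [map_smul, Matrix.smul_apply]
  simp [A, hx, Algebra.smul_def, mul_comm]

namespace IsHomogeneousPolynomialFunction

variable {k V : Type*} [AddCommGroup V] {r : ℕ}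

theorem map_smul [Field k] [Module k V] {ν : V → k} (hν : IsHomogeneousPolynomialFunction k r ν)
    (a : k) (x : V) : ν (a • x) = a ^ r * ν x := by
  obtain ⟨b, P, hP, hval⟩ := hν
  rw [hval, hval, _root_.map_smul]
  exact eval_smul_of_isHomogeneous hP a _

theorem isNonarchVectorNorm [NormedField k] [Module k V] {ν : V → k}
    (hν : IsHomogeneousPolynomialFunction k r ν) (hr : 0 < r) (hdef : ∀ x, ν x = 0 ↔ x = 0)
    (hadd : ∀ x y, ‖ν (x + y)‖ ≤ max ‖ν x‖ ‖ν y‖) :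
    IsNonarchVectorNorm k (fun x : V => ‖ν x‖ ^ ((1 : ℝ) / r)) := by
  have hr' : (0 : ℝ) < 1 / r := by positivity
  have hnonneg : ∀ x, 0 ≤ ‖ν x‖ ^ ((1 : ℝ) / r) := fun x => by positivity
  have hmax : ∀ x y, ‖ν (x + y)‖ ^ ((1 : ℝ) / r) ≤
      max (‖ν x‖ ^ ((1 : ℝ) / r)) (‖ν y‖ ^ ((1 : ℝ) / r)) := fun x y => by
    rw [← (Real.monotoneOn_rpow_Ici_of_exponent_nonneg hr'.le).map_max (norm_nonneg _)
      (norm_nonneg _)]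
    exact Real.rpow_le_rpow (norm_nonneg _) (hadd x y) hr'.le
  refine ⟨⟨hnonneg, fun x => ?_, fun a x => ?_, fun x y => ?_⟩, hmax⟩
  · rw [Real.rpow_eq_zero (norm_nonneg _) hr'.ne', norm_eq_zero, hdef]
  · rw [hν.map_smul, norm_mul, norm_pow, Real.mul_rpow (by positivity) (norm_nonneg _), one_div,
      Real.pow_rpow_inv_natCast (norm_nonneg _) hr.ne']
  · exact (hmax x y).trans (max_le_add_of_nonneg (hnonneg x) (hnonneg y))

end IsHomogeneousPolynomialFunction

theorem IsReducedNorm.isHomogeneousPolynomialFunction_comp {k D : Type u} {V : Type*} [Field k]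
    [Ring D] [Algebra k D] {r : ℕ} {nrd : D → k} (hnrd : IsReducedNorm k D r nrd)
    [AddCommGroup V] [Module k V] [FiniteDimensional k V] (ι : V →ₗ[k] D) :
    IsHomogeneousPolynomialFunction k r (nrd ∘ ι) := by
  obtain ⟨K, _, _, ⟨F⟩⟩ := hnrd.exists_splitting
  let φ : V →ₗ[k] Matrix (Fin r) (Fin r) K :=
    (F.toLinearMap.restrictScalars k ∘ₗ TensorProduct.mk k K D 1) ∘ₗ ι
  simpa [Function.comp_def] using isHomogeneousPolynomialFunction_of_det φ
    fun x => hnrd.eq_det K F (ι x)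

/-! ### Determinants with a dominant generalized diagonal -/

theorem norm_det_eq_prod_of_forall_prod_lt {L n : Type*} [NormedField L] [IsUltrametricDist L]
    [Fintype n] [DecidableEq n] {M : Matrix n n L} {τ₀ : Equiv.Perm n}
    (h : ∀ τ ≠ τ₀, ∏ i, ‖M (τ i) i‖ < ∏ i, ‖M (τ₀ i) i‖) : ‖M.det‖ = ∏ i, ‖M (τ₀ i) i‖ := by
  have hterm : ∀ τ : Equiv.Perm n,
      ‖Equiv.Perm.sign τ • ∏ i, M (τ i) i‖ = ∏ i, ‖M (τ i) i‖ := fun τ => by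
    rcases Int.units_eq_one_or (Equiv.Perm.sign τ) with h | h <;> simp [h, norm_prod]
  rw [Matrix.det_apply, ← Finset.add_sum_erase _ _ (Finset.mem_univ τ₀), ← hterm]
  rcases (Finset.univ.erase τ₀).eq_empty_or_nonempty with hempty | hne
  · rw [hempty, Finset.sum_empty, add_zero]
  · obtain ⟨τ, hτ, hle⟩ := IsUltrametricDist.exists_norm_finsetSum_le_of_nonempty hne
      fun τ : Equiv.Perm n => Equiv.Perm.sign τ • ∏ i, M (τ i) i
    have hlt := hle.trans_lt ((hterm τ).trans_lt (h τ (Finset.ne_of_mem_erase hτ)))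
    rw [← hterm] at hlt
    rw [IsUltrametricDist.norm_add_eq_max_of_norm_ne_norm hlt.ne', max_eq_left hlt.le]

theorem prod_lt_prod_const_of_forall_lt {ι α : Type*} [Fintype ι] {w : α → ℝ}
    (hw : ∀ a, 0 ≤ w a) {c : α} (hc : ∀ a ≠ c, w a < w c) {f : ι → α} (hf : ∃ j, f j ≠ c) :
    ∏ i, w (f i) < w c ^ Fintype.card ι := by
  obtain ⟨j, hj⟩ := hf
  have hpos : 0 < w c := (hw _).trans_lt (hc _ hj)
  have hle : ∀ a, w a ≤ w c := fun a => by
    rcases eq_or_ne a c with rfl | h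
    exacts [le_rfl, (hc a h).le]
  rw [← Finset.card_univ, ← Finset.prod_const]
  by_cases hzero : ∃ i, w (f i) = 0
  · obtain ⟨i, hi⟩ := hzero
    rw [Finset.prod_eq_zero (Finset.mem_univ i) hi]
    exact Finset.prod_pos fun _ _ => hpos
  · push Not at hzero
    exact Finset.prod_lt_prod (fun i _ => (hw _).lt_of_ne' (hzero i)) (fun i _ => hle _)
      ⟨j, Finset.mem_univ j, hc _ hj⟩

/-- Up to the row and column scaling by `s`, the absolute values of the entries of `M` form a
circulant matrix, and the translates of its largest entry form the dominant diagonal. -/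
theorem norm_det_eq_pow_of_circulant {L G : Type*} [NormedField L] [IsUltrametricDist L]
    [AddGroup G] [Fintype G] [DecidableEq G] {M : Matrix G G L} {w s : G → ℝ} (hs : ∀ i, 0 < s i)
    (hM : ∀ i j, ‖M i j‖ * s j = w (j - i) * s i) {c : G} (hc : ∀ g ≠ c, w g < w c) :
    ‖M.det‖ = w c ^ Fintype.card G := by
  have hw : ∀ g, 0 ≤ w g := fun g => by
    have h := hM 0 g
    rw [sub_zero] at h
    exact nonneg_of_mul_nonneg_left (h ▸ mul_nonneg (norm_nonneg _) (hs g).le) (hs 0)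
  have hprod : ∀ τ : Equiv.Perm G, ∏ i, ‖M (τ i) i‖ = ∏ i, w (i - τ i) := fun τ => by
    refine mul_right_cancel₀ (b := ∏ i, s i) (Finset.prod_pos fun i _ => hs i).ne' ?_
    rw [← Finset.prod_mul_distrib, Finset.prod_congr rfl fun i _ => hM (τ i) i,
      Finset.prod_mul_distrib, Equiv.prod_comp τ s]
  have hτ₀ : ∏ i, ‖M (Equiv.addLeft (-c) i) i‖ = w c ^ Fintype.card G := by
    rw [hprod]
    simp [sub_eq_add_neg]
  rw [← hτ₀]
  refine norm_det_eq_prod_of_forall_prod_lt fun τ hτ => ?_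
  rw [hτ₀, hprod]
  refine prod_lt_prod_const_of_forall_lt hw hc ?_
  by_contra! h
  refine hτ (Equiv.ext fun i => ?_)
  change τ i = -c + i
  rw [← h i, neg_sub, sub_add_cancel]

/-! ### Cyclic algebras -/

section TwistedCommutant

variable {k L n : Type*} [Field k] [Field L] [Algebra k L] [Fintype n] [DecidableEq n]

/-- The matrices commuting with the `σ`-semilinear map `x ↦ U σ(x)`. -/
def twistedCommutant (σ : L ≃ₐ[k] L) (U : Matrix n n L) : Subalgebra k (Matrix n n L) where
  carrier := {M | U * σ.mapMatrix M = M * U}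
  mul_mem' {M N} (hM : _ = _) (hN : _ = _) := show _ = _ by
    rw [map_mul, ← mul_assoc, hM, mul_assoc, hN, mul_assoc]
  add_mem' {M N} (hM : _ = _) (hN : _ = _) := show _ = _ by
    rw [map_add, mul_add, add_mul, hM, hN]
  algebraMap_mem' a := show _ = _ by rw [AlgEquiv.commutes, Algebra.commutes]

variable {σ : L ≃ₐ[k] L} {U M : Matrix n n L}

theorem mem_twistedCommutant : M ∈ twistedCommutant σ U ↔ U * σ.mapMatrix M = M * U := Iff.rfl

theorem apply_det_of_mem_twistedCommutant (hU : U.det ≠ 0) (hM : M ∈ twistedCommutant σ U) :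
    σ M.det = M.det := by
  have h := congrArg Matrix.det (mem_twistedCommutant.mp hM)
  rw [Matrix.det_mul, Matrix.det_mul, mul_comm, ← AlgEquiv.map_det] at h
  exact mul_right_cancel₀ hU h

theorem map_eq_of_mem_twistedCommutant_of_commute (hU : U.det ≠ 0)
    (hM : M ∈ twistedCommutant σ U) (hcomm : M * U = U * M) (i j : n) : σ (M i j) = M i j := by
  have h : σ.mapMatrix M = M := by
    refine (Matrix.isUnit_iff_isUnit_det U).mpr hU.isUnit |>.mul_left_cancel ?_
    rw [mem_twistedCommutant.mp hM, hcomm]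
  exact congrFun (congrFun h i) j

end TwistedCommutant

section CyclicAlgebra

/-- The weights of the cyclic shift: `a` at the wrap-around `r - 1 ↦ 0`, and `1` elsewhere. -/
def wrapWeight {L : Type*} [One L] (a : L) {r : ℕ} [NeZero r] (i : Fin r) : L :=
  if i + 1 = 0 then a else 1

/-- The carry of the subtraction `j - i` in `Fin r`, recorded multiplicatively as a power of `a`. -/
def carryWeight {L : Type*} [One L] (a : L) {r : ℕ} (i j : Fin r) : L :=
  if j < i then a else 1

/-- The weighted cyclic shift, with entry `wrapWeight a i` at `(i, i + 1)`. -/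
def shiftMatrix {L : Type*} [Zero L] [One L] (a : L) (r : ℕ) [NeZero r] :
    Matrix (Fin r) (Fin r) L :=
  Matrix.of fun i j => if j = i + 1 then wrapWeight a i else 0

variable {k L : Type*} [Field k] [Field L] [Algebra k L]

/-- The cyclic algebra attached to `σ` and `π`, realised in the `r × r` matrices over `L`. -/
def cyclicAlgebra (σ : L ≃ₐ[k] L) (π : k) (r : ℕ) [NeZero r] :
    Subalgebra k (Matrix (Fin r) (Fin r) L) :=
  twistedCommutant σ (shiftMatrix (algebraMap k L π) r)

/-- The element of the cyclic algebra with first row `x`. -/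
def cyclicMatrix (σ : L ≃ₐ[k] L) (π : k) {r : ℕ} [NeZero r] (x : Fin r → L) :
    Matrix (Fin r) (Fin r) L :=
  Matrix.of fun i j => (σ⁻¹ ^ (i : ℕ)) (x (j - i)) * carryWeight (algebraMap k L π) i j

variable {σ : L ≃ₐ[k] L} {π : k} {r : ℕ} [NeZero r]

theorem exists_algebraMap_eq_of_generator [FiniteDimensional k L] [IsGalois k L]
    (hgen : ∀ τ : L ≃ₐ[k] L, τ ∈ Subgroup.zpowers σ) {x : L} (hx : σ x = x) :
    ∃ a : k, algebraMap k L a = x := by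
  have hσ : σ ∈ MulAction.stabilizer (L ≃ₐ[k] L) x := hx
  exact (IsGalois.mem_range_algebraMap_iff_fixed x).mpr fun τ =>
    Subgroup.zpowers_le.mpr hσ (hgen τ)

theorem wrapWeight_ne_zero {a : L} (ha : a ≠ 0) (i : Fin r) : wrapWeight a i ≠ 0 := by
  unfold wrapWeight
  split_ifs
  exacts [ha, one_ne_zero]

theorem shiftMatrix_eq_diagonal_mul_permMatrix (a : L) :
    shiftMatrix a r = Matrix.diagonal (wrapWeight a) * (Equiv.addRight 1).permMatrix L := by
  ext i j
  simp [shiftMatrix, Matrix.diagonal_mul, Equiv.Perm.permMatrix, PEquiv.toMatrix_apply, eq_comm]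

theorem det_shiftMatrix_ne_zero {a : L} (ha : a ≠ 0) : (shiftMatrix a r).det ≠ 0 := by
  rw [shiftMatrix_eq_diagonal_mul_permMatrix, Matrix.det_mul, Matrix.det_diagonal,
    Matrix.det_permutation]
  refine mul_ne_zero (Finset.prod_ne_zero_iff.mpr fun i _ => wrapWeight_ne_zero ha i) ?_
  exact ((Equiv.Perm.sign _).isUnit.map (Int.castRingHom L)).ne_zero

theorem mem_cyclicAlgebra_iff {M : Matrix (Fin r) (Fin r) L} :
    M ∈ cyclicAlgebra σ π r ↔ ∀ i j, wrapWeight (algebraMap k L π) i * σ (M (i + 1) (j + 1)) =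
      M i j * wrapWeight (algebraMap k L π) j := by
  rw [cyclicAlgebra, mem_twistedCommutant, shiftMatrix_eq_diagonal_mul_permMatrix, ← mul_assoc,
    mul_assoc (Matrix.diagonal _), Equiv.Perm.permMatrix, PEquiv.toMatrix_toPEquiv_mul,
    PEquiv.mul_toMatrix_toPEquiv, ← Matrix.ext_iff]
  refine forall_congr' fun i => (Equiv.addRight (1 : Fin r)).forall_congr_right.symm.trans ?_
  simp [Matrix.diagonal_mul, Matrix.mul_diagonal]

theorem shiftMatrix_mem_cyclicAlgebra : shiftMatrix (algebraMap k L π) r ∈ cyclicAlgebra σ π r := by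
  have h : σ.mapMatrix (shiftMatrix (algebraMap k L π) r) = shiftMatrix (algebraMap k L π) r := by
    ext i j
    simp only [shiftMatrix, wrapWeight, AlgEquiv.mapMatrix_apply, Matrix.map_apply,
      Matrix.of_apply, apply_ite σ, map_one, map_zero, AlgEquiv.commutes]
  rw [cyclicAlgebra, mem_twistedCommutant, h]

theorem apply_inv_pow_val_add_one (hσ : σ ^ r = 1) (i : Fin r) (x : L) :
    σ ((σ⁻¹ ^ ((i + 1 : Fin r) : ℕ)) x) = (σ⁻¹ ^ (i : ℕ)) x := by
  have hsucc : ∀ m : ℕ, σ ((σ⁻¹ ^ (m + 1)) x) = (σ⁻¹ ^ m) x := fun m => by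
    rw [pow_succ', ← AlgEquiv.mul_apply, ← mul_assoc, mul_inv_cancel, one_mul]
  obtain ⟨n, rfl⟩ := Nat.exists_eq_succ_of_ne_zero (NeZero.ne r)
  cases i using Fin.lastCases with
  | last => rw [Fin.last_add_one, Fin.val_last, ← hsucc n, inv_pow σ (n + 1), hσ, inv_one]; rfl
  | cast i => rw [Fin.coeSucc_eq_succ, Fin.val_succ, Fin.val_castSucc, hsucc]

theorem wrapWeight_mul_carryWeight (a : L) (i j : Fin r) :
    wrapWeight a i * carryWeight a (i + 1) (j + 1) = carryWeight a i j * wrapWeight a j := by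
  obtain ⟨n, rfl⟩ := Nat.exists_eq_succ_of_ne_zero (NeZero.ne r)
  cases i using Fin.lastCases <;> cases j using Fin.lastCases <;>
    simp [wrapWeight, carryWeight, Fin.castSucc_lt_last, (Fin.le_last _).not_gt]

theorem cyclicMatrix_mem_cyclicAlgebra (hσ : σ ^ r = 1) (x : Fin r → L) :
    cyclicMatrix σ π x ∈ cyclicAlgebra σ π r := by
  refine mem_cyclicAlgebra_iff.mpr fun i j => ?_
  have hcarry : ∀ i j : Fin r, σ (carryWeight (algebraMap k L π) i j) =
      carryWeight (algebraMap k L π) i j := fun i j => by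
    simp only [carryWeight, apply_ite σ, AlgEquiv.commutes, map_one]
  simp only [cyclicMatrix, Matrix.of_apply]
  rw [map_mul, apply_inv_pow_val_add_one hσ, hcarry, add_sub_add_right_eq_sub, mul_left_comm,
    wrapWeight_mul_carryWeight, mul_assoc]

theorem cyclicMatrix_zero (x : Fin r → L) : cyclicMatrix σ π x 0 = x := by
  ext j
  simp only [cyclicMatrix, carryWeight, Matrix.of_apply, sub_zero, Fin.not_lt_zero, if_false,
    mul_one, Fin.val_zero, pow_zero, AlgEquiv.one_apply]

theorem eq_zero_of_mem_cyclicAlgebra (hπ : π ≠ 0) {M : Matrix (Fin r) (Fin r) L}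
    (hM : M ∈ cyclicAlgebra σ π r) (h : M 0 = 0) : M = 0 := by
  have hstep : ∀ i, M i = 0 → M (i + 1) = 0 := fun i hi => by
    ext j
    have hij := mem_cyclicAlgebra_iff.mp hM i (j - 1)
    rw [hi, Pi.zero_apply, zero_mul, sub_add_cancel] at hij
    exact (map_eq_zero_iff σ σ.injective).mp
      ((mul_eq_zero_iff_left (wrapWeight_ne_zero (by simpa using hπ) i)).mp hij)
  obtain ⟨n, rfl⟩ := Nat.exists_eq_succ_of_ne_zero (NeZero.ne r)
  funext i
  induction i using Fin.induction with
  | zero => exact h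
  | succ i ih => exact Fin.coeSucc_eq_succ ▸ hstep _ ih

theorem eq_of_mem_cyclicAlgebra (hπ : π ≠ 0) {M N : Matrix (Fin r) (Fin r) L}
    (hM : M ∈ cyclicAlgebra σ π r) (hN : N ∈ cyclicAlgebra σ π r) (h : M 0 = N 0) : M = N :=
  sub_eq_zero.mp <| eq_zero_of_mem_cyclicAlgebra hπ (sub_mem hM hN) <| sub_eq_zero.mpr h

theorem eq_cyclicMatrix_of_mem (hσ : σ ^ r = 1) (hπ : π ≠ 0) {M : Matrix (Fin r) (Fin r) L}
    (hM : M ∈ cyclicAlgebra σ π r) : M = cyclicMatrix σ π (M 0) :=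
  eq_of_mem_cyclicAlgebra hπ hM (cyclicMatrix_mem_cyclicAlgebra hσ _) (cyclicMatrix_zero _).symm

theorem finrank_cyclicAlgebra [FiniteDimensional k L] (hσ : σ ^ r = 1) (hπ : π ≠ 0) :
    Module.finrank k (cyclicAlgebra σ π r) = r * Module.finrank k L := by
  let row : cyclicAlgebra σ π r →ₗ[k] Fin r → L :=
    LinearMap.proj (R := k) (φ := fun _ : Fin r => Fin r → L) 0 ∘ₗ
      (cyclicAlgebra σ π r).val.toLinearMap
  have hrow : Function.Bijective row :=
    ⟨fun M N h => Subtype.ext (eq_of_mem_cyclicAlgebra hπ M.2 N.2 h),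
      fun x => ⟨⟨_, cyclicMatrix_mem_cyclicAlgebra hσ x⟩, cyclicMatrix_zero x⟩⟩
  rw [(LinearEquiv.ofBijective row hrow).finrank_eq]
  simpa using Module.finrank_pi_fintype k (M := fun _ : Fin r => L)

theorem cyclicMatrix_single (x : L) :
    cyclicMatrix σ π (Pi.single (0 : Fin r) x) =
      Matrix.diagonal fun i : Fin r => (σ⁻¹ ^ (i : ℕ)) x := by
  ext i j
  rcases eq_or_ne i j with rfl | hij
  · simp [cyclicMatrix, carryWeight]
  · simp [cyclicMatrix, hij, Pi.single_eq_of_ne (sub_ne_zero.mpr hij.symm)]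

theorem eq_single_of_commute_diagonal (hσ : orderOf σ = r) {M : Matrix (Fin r) (Fin r) L}
    (hM : ∀ x, M * cyclicMatrix σ π (Pi.single 0 x) = cyclicMatrix σ π (Pi.single 0 x) * M) :
    M 0 = Pi.single 0 (M 0 0) := by
  ext j
  rcases eq_or_ne j 0 with rfl | hj
  · simp
  rw [Pi.single_eq_of_ne hj]
  by_contra hne
  have hj_eq : σ⁻¹ ^ (j : ℕ) ≠ σ⁻¹ ^ ((0 : Fin r) : ℕ) := fun h => hj <| Fin.ext <|
    pow_injOn_Iio_orderOf (by simp [hσ]) (by simp [hσ, NeZero.pos r]) h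
  refine hj_eq (AlgEquiv.ext fun x => ?_)
  have h := congrFun (congrFun (hM x) 0) j
  rw [cyclicMatrix_single, Matrix.mul_diagonal, Matrix.diagonal_mul, mul_comm] at h
  exact mul_right_cancel₀ hne h

theorem isCentral_cyclicAlgebra [FiniteDimensional k L] [IsGalois k L] (hσ : orderOf σ = r)
    (hgen : ∀ τ : L ≃ₐ[k] L, τ ∈ Subgroup.zpowers σ) (hπ : π ≠ 0) :
    Algebra.IsCentral k (cyclicAlgebra σ π r) := by
  have hσr : σ ^ r = 1 := hσ ▸ pow_orderOf_eq_one σ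
  refine ⟨fun ⟨M, hM⟩ hcenter => ?_⟩
  have hcomm : ∀ N ∈ cyclicAlgebra σ π r, M * N = N * M := fun N hN =>
    congrArg Subtype.val (Subalgebra.mem_center_iff.mp hcenter ⟨N, hN⟩).symm
  have hrow : M 0 = Pi.single 0 (M 0 0) := eq_single_of_commute_diagonal hσ fun x =>
    hcomm _ (cyclicMatrix_mem_cyclicAlgebra (π := π) hσr _)
  have hfixed : σ (M 0 0) = M 0 0 := map_eq_of_mem_twistedCommutant_of_commute
    (det_shiftMatrix_ne_zero (by simpa using hπ)) hM (hcomm _ shiftMatrix_mem_cyclicAlgebra) 0 0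
  obtain ⟨a, ha⟩ := exists_algebraMap_eq_of_generator hgen hfixed
  have hscalar : algebraMap k (Matrix (Fin r) (Fin r) L) a = M := by
    refine eq_of_mem_cyclicAlgebra hπ (algebraMap_mem _ a) hM (funext fun j => ?_)
    rw [hrow, ← ha, Matrix.algebraMap_matrix_apply, Pi.single_apply]
    exact if_congr eq_comm rfl rfl
  exact Algebra.mem_bot.mpr ⟨a, Subtype.ext hscalar⟩

end CyclicAlgebra

section Norm

variable {L : Type*} [NormedField L] {r : ℕ}

/-- The gauge `max ρ ^ j ‖x j‖` of a row, for which `Nrd` has absolute value the `r`-th power of the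
gauge of the first row. -/
def weightedSupNorm (ρ : ℝ) (x : Fin r → L) : ℝ :=
  ‖fun j : Fin r => ρ ^ (j : ℕ) * ‖x j‖‖

variable {ρ : ℝ}

theorem weightedSupNorm_eq_of_le (hρ0 : 0 < ρ) {x : Fin r → L} {c : Fin r}
    (hc : ∀ j : Fin r, ρ ^ (j : ℕ) * ‖x j‖ ≤ ρ ^ (c : ℕ) * ‖x c‖) :
    weightedSupNorm ρ x = ρ ^ (c : ℕ) * ‖x c‖ := by
  have hnorm : ∀ j : Fin r, ‖ρ ^ (j : ℕ) * ‖x j‖‖ = ρ ^ (j : ℕ) * ‖x j‖ := fun j =>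
    Real.norm_of_nonneg (by positivity)
  refine le_antisymm ((pi_norm_le_iff_of_nonneg (by positivity)).mpr fun j => ?_) ?_
  · exact (hnorm j).trans_le (hc j)
  · exact (hnorm c).symm.trans_le (norm_le_pi_norm (fun j : Fin r => ρ ^ (j : ℕ) * ‖x j‖) c)

theorem weightedSupNorm_eq_zero_iff (hρ0 : 0 < ρ) {x : Fin r → L} :
    weightedSupNorm ρ x = 0 ↔ x = 0 := by
  simp [weightedSupNorm, funext_iff, hρ0.ne']

theorem weightedSupNorm_add_le [IsUltrametricDist L] (hρ0 : 0 < ρ) (x y : Fin r → L) :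
    weightedSupNorm ρ (x + y) ≤ max (weightedSupNorm ρ x) (weightedSupNorm ρ y) := by
  have hle : ∀ (z : Fin r → L) (j : Fin r), ρ ^ (j : ℕ) * ‖z j‖ ≤ weightedSupNorm ρ z :=
    fun z j => (le_abs_self _).trans (norm_le_pi_norm (fun j : Fin r => ρ ^ (j : ℕ) * ‖z j‖) j)
  refine (pi_norm_le_iff_of_nonneg (le_max_of_le_left (norm_nonneg _))).mpr fun j => ?_
  rw [Real.norm_of_nonneg (by positivity)]
  calc ρ ^ (j : ℕ) * ‖x j + y j‖ ≤ ρ ^ (j : ℕ) * max ‖x j‖ ‖y j‖ := by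
        gcongr
        exact IsUltrametricDist.norm_add_le_max _ _
    _ = max (ρ ^ (j : ℕ) * ‖x j‖) (ρ ^ (j : ℕ) * ‖y j‖) := mul_max_of_nonneg _ _ (by positivity)
    _ ≤ max (weightedSupNorm ρ x) (weightedSupNorm ρ y) := max_le_max (hle x j) (hle y j)

theorem eq_of_pow_mul_norm_eq (hρ0 : 0 < ρ) (hρ1 : ρ ≠ 1)
    (hval : ∀ x : L, x ≠ 0 → ∃ m : ℤ, ‖x‖ = (ρ ^ r) ^ m) {i j : Fin r} {x y : L}
    (hx : x ≠ 0) (h : ρ ^ (i : ℕ) * ‖x‖ = ρ ^ (j : ℕ) * ‖y‖) : i = j := by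
  have hy : y ≠ 0 := by
    rintro rfl
    rw [norm_zero, mul_zero] at h
    exact mul_ne_zero (pow_pos hρ0 _).ne' (norm_ne_zero_iff.mpr hx) h
  obtain ⟨m, hm⟩ := hval x hx
  obtain ⟨n, hn⟩ := hval y hy
  rw [hm, hn, ← zpow_natCast, ← zpow_natCast, ← zpow_natCast, ← zpow_mul, ← zpow_mul,
    ← zpow_add₀ hρ0.ne', ← zpow_add₀ hρ0.ne'] at h
  have hexp : (i : ℤ) + r * m = j + r * n := zpow_right_injective₀ hρ0 hρ1 h
  have hmod := congrArg (· % (r : ℤ)) hexp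
  simp only [Int.add_mul_emod_self_left] at hmod
  rw [← Int.natCast_mod, ← Int.natCast_mod, Nat.mod_eq_of_lt i.isLt, Nat.mod_eq_of_lt j.isLt]
    at hmod
  exact Fin.ext (by exact_mod_cast hmod)

variable {k : Type*} [NormedField k] [NormedAlgebra k L] [NeZero r] {σ : L ≃ₐ[k] L} {π : k}

theorem norm_cyclicMatrix_mul_pow (hiso : ∀ x, ‖σ x‖ = ‖x‖) (hρ : ρ ^ r = ‖π‖) (x : Fin r → L)
    (i j : Fin r) : ‖cyclicMatrix σ π x i j‖ * ρ ^ (j : ℕ) =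
      ρ ^ ((j - i : Fin r) : ℕ) * ‖x (j - i)‖ * ρ ^ (i : ℕ) := by
  have hiso' : ∀ (m : ℕ) (y : L), ‖(σ⁻¹ ^ m) y‖ = ‖y‖ := fun m y => by
    induction m with
    | zero => rfl
    | succ m ih =>
      rw [pow_succ', AlgEquiv.mul_apply, ← hiso, ← AlgEquiv.mul_apply, mul_inv_cancel,
        AlgEquiv.one_apply, ih]
  have hcarry : ‖carryWeight (algebraMap k L π) i j‖ * ρ ^ (j : ℕ) =
      ρ ^ ((j - i : Fin r) : ℕ) * ρ ^ (i : ℕ) := by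
    rw [carryWeight, ← pow_add]
    split_ifs with hji
    · rw [norm_algebraMap', ← hρ, ← pow_add, Fin.coe_sub_iff_lt.mpr hji]
      congr 1
      omega
    · rw [norm_one, one_mul, Fin.coe_sub_iff_le.mpr (not_lt.mp hji)]
      congr 1
      omega
  rw [cyclicMatrix, Matrix.of_apply, norm_mul, hiso', mul_assoc, hcarry]
  ring

theorem det_eq_zero_iff_of_norm_det_eq (hπ : π ≠ 0) (hρ0 : 0 < ρ)
    (hdet : ∀ M ∈ cyclicAlgebra σ π r, ‖M.det‖ = weightedSupNorm ρ (M 0) ^ r)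
    {M : Matrix (Fin r) (Fin r) L} (hM : M ∈ cyclicAlgebra σ π r) : M.det = 0 ↔ M = 0 := by
  rw [← norm_eq_zero, hdet M hM, pow_eq_zero_iff (NeZero.ne r), weightedSupNorm_eq_zero_iff hρ0]
  exact ⟨eq_zero_of_mem_cyclicAlgebra hπ hM, fun h => h ▸ rfl⟩

theorem norm_det_add_le_of_norm_det_eq [IsUltrametricDist L] (hρ0 : 0 < ρ)
    (hdet : ∀ M ∈ cyclicAlgebra σ π r, ‖M.det‖ = weightedSupNorm ρ (M 0) ^ r)
    {M N : Matrix (Fin r) (Fin r) L} (hM : M ∈ cyclicAlgebra σ π r)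
    (hN : N ∈ cyclicAlgebra σ π r) : ‖(M + N).det‖ ≤ max ‖M.det‖ ‖N.det‖ := by
  have hnn : ∀ x : Fin r → L, 0 ≤ weightedSupNorm ρ x := fun x => norm_nonneg _
  rw [hdet _ (add_mem hM hN), hdet M hM, hdet N hN]
  rcases le_max_iff.mp (weightedSupNorm_add_le hρ0 (M 0) (N 0)) with h | h
  · exact le_max_of_le_left (pow_le_pow_left₀ (hnn _) h r)
  · exact le_max_of_le_right (pow_le_pow_left₀ (hnn _) h r)

variable [IsUltrametricDist L]

/-- The classes of `1, ρ, …, ρ ^ (r - 1)` modulo the value group of `L` are distinct, so the largest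
term of the gauge is attained only once. -/
theorem norm_det_eq_weightedSupNorm_pow (hσ : σ ^ r = 1) (hiso : ∀ x, ‖σ x‖ = ‖x‖) (hρ0 : 0 < ρ)
    (hρ : ρ ^ r = ‖π‖)
    (hdistinct : ∀ (i j : Fin r) (x y : L), x ≠ 0 → ρ ^ (i : ℕ) * ‖x‖ = ρ ^ (j : ℕ) * ‖y‖ → i = j)
    {M : Matrix (Fin r) (Fin r) L} (hM : M ∈ cyclicAlgebra σ π r) :
    ‖M.det‖ = weightedSupNorm ρ (M 0) ^ r := by
  have hπ : π ≠ 0 := norm_ne_zero_iff.mp (hρ ▸ (pow_pos hρ0 r).ne')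
  rcases eq_or_ne M 0 with rfl | hne
  · have hzero : weightedSupNorm ρ ((0 : Matrix (Fin r) (Fin r) L) 0) = 0 :=
      (weightedSupNorm_eq_zero_iff hρ0).mpr rfl
    rw [Matrix.det_zero, norm_zero, hzero, zero_pow (NeZero.ne r)]
  obtain ⟨c, hc⟩ := Finite.exists_max fun j : Fin r => ρ ^ (j : ℕ) * ‖M 0 j‖
  have hsup := weightedSupNorm_eq_of_le hρ0 hc
  have hMc : M 0 c ≠ 0 := fun h => by
    rw [h, norm_zero, mul_zero, weightedSupNorm_eq_zero_iff hρ0] at hsup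
    exact hne (eq_zero_of_mem_cyclicAlgebra hπ hM hsup)
  have hunique : ∀ j ≠ c, ρ ^ (j : ℕ) * ‖M 0 j‖ < ρ ^ (c : ℕ) * ‖M 0 c‖ := fun j hj =>
    (hc j).lt_of_ne fun h => hj (hdistinct c j _ _ hMc h.symm).symm
  rw [hsup, norm_det_eq_pow_of_circulant (w := fun j : Fin r => ρ ^ (j : ℕ) * ‖M 0 j‖)
    (fun i : Fin r => pow_pos hρ0 (i : ℕ)) (fun i j => ?_) hunique, Fintype.card_fin]
  conv_lhs => rw [eq_cyclicMatrix_of_mem hσ hπ hM]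
  exact norm_cyclicMatrix_mul_pow hiso hρ (M 0) i j

end Norm

/-! ### Residue fields and unramified extensions -/

section ResidueField

open IsLocalRing

/-- The valuation ring of a non-archimedean normed field. -/
noncomputable abbrev normInteger (K : Type*) [NormedField K] [IsUltrametricDist K] :
    ValuationSubring K :=
  (NormedField.valuation (K := K)).valuationSubring

section NormedField

variable {K : Type*} [NormedField K] [IsUltrametricDist K]

theorem mem_normInteger {x : K} : x ∈ normInteger K ↔ ‖x‖ ≤ 1 := by
  rw [Valuation.mem_valuationSubring_iff, NormedField.valuation_apply, ← NNReal.coe_le_coe,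
    coe_nnnorm, NNReal.coe_one]

theorem normInteger.isUnit_iff {x : normInteger K} : IsUnit x ↔ ‖(x : K)‖ = 1 := by
  have h := Valuation.integer.integers (NormedField.valuation (K := K))
  exact (h.isUnit_iff_valuation_eq_one (x := x)).trans NNReal.coe_inj.symm

theorem normInteger.residue_ne_zero_iff {x : normInteger K} :
    residue (normInteger K) x ≠ 0 ↔ ‖(x : K)‖ = 1 := by
  rw [residue_ne_zero_iff_isUnit, normInteger.isUnit_iff]

end NormedField

section LocallyCompact

variable (k : Type*) [NontriviallyNormedField k] [IsUltrametricDist k] [LocallyCompactSpace k]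

open scoped NormedField Valued in
theorem normInteger.isDiscreteValuationRing_and_finite_residueField :
    IsDiscreteValuationRing (normInteger k) ∧ Finite (ResidueField (normInteger k)) := by
  have : ProperSpace k := ProperSpace.of_locallyCompactSpace k
  have hball : (𝒪[k] : Set k) = Metric.closedBall 0 1 := by
    ext x
    exact Valued.integer.mem_iff.trans mem_closedBall_zero_iff.symm
  have hcompact : CompactSpace 𝒪[k] :=
    isCompact_iff_compactSpace.mp (hball ▸ isCompact_closedBall (0 : k) 1)
  let : (Valued.v : Valuation k NNReal).RankOne :=
    inferInstanceAs (NormedField.valuation (K := k)).RankOne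
  open Valued.integer in
  exact (compactSpace_iff_completeSpace_and_isDiscreteValuationRing_and_finite_residueField.mp
    hcompact).2

theorem exists_uniformizer :
    ∃ π : k, π ≠ 0 ∧ ‖π‖ < 1 ∧ ∀ x : k, x ≠ 0 → ∃ m : ℤ, ‖x‖ = ‖π‖ ^ m := by
  have := (normInteger.isDiscreteValuationRing_and_finite_residueField k).1
  obtain ⟨π, hπ⟩ := IsDiscreteValuationRing.exists_irreducible (normInteger k)
  have hpow : ∀ x : k, x ≠ 0 → ‖x‖ ≤ 1 → ∃ n : ℕ, ‖x‖ = ‖(π : k)‖ ^ n := fun x hx hx1 => by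
    obtain ⟨n, w, h⟩ := IsDiscreteValuationRing.eq_unit_mul_pow_irreducible
      (x := (⟨x, mem_normInteger.mpr hx1⟩ : normInteger k))
      (fun h => hx (congrArg Subtype.val h)) hπ
    have hx_eq : x = (w : normInteger k) * (π : k) ^ n := congrArg Subtype.val h
    exact ⟨n, by
      rw [hx_eq, norm_mul, norm_pow, normInteger.isUnit_iff.mp w.isUnit, one_mul]⟩
  refine ⟨π, fun h => hπ.ne_zero (Subtype.ext h), ?_, fun x hx => ?_⟩
  · exact (mem_normInteger.mp π.2).lt_of_ne (hπ.not_isUnit ∘ normInteger.isUnit_iff.mpr)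
  rcases le_total ‖x‖ 1 with h | h
  · obtain ⟨n, hn⟩ := hpow x hx h
    exact ⟨n, by rw [hn, zpow_natCast]⟩
  · obtain ⟨n, hn⟩ := hpow x⁻¹ (inv_ne_zero hx) (norm_inv x ▸ inv_le_one_of_one_le₀ h)
    exact ⟨-n, by rw [zpow_neg, zpow_natCast, ← hn, norm_inv, inv_inv]⟩

end LocallyCompact

section Extension

variable {k L : Type*} [NormedField k] [IsUltrametricDist k] [NormedField L]
  [IsUltrametricDist L] [NormedAlgebra k L]

instance hasExtension_normValuation :
    (NormedField.valuation (K := k)).HasExtension (NormedField.valuation (K := L)) where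
  val_isEquiv_comap x y := by simp [nnnorm_algebraMap']

theorem norm_sum_smul_eq_one_of_linearIndependent_residue {ι : Type*} [Fintype ι]
    {y : ι → normInteger L}
    (hy : LinearIndependent (ResidueField (normInteger k)) fun i => residue (normInteger L) (y i))
    (a : ι → normInteger k) {j : ι} (hj : ‖(a j : k)‖ = 1) :
    ‖∑ i, (a i : k) • (y i : L)‖ = 1 := by
  let z : normInteger L := ∑ i, a i • y i
  have hz : (z : L) = ∑ i, (a i : k) • (y i : L) := map_sum (normInteger L).subtype _ _
  have hres : residue (normInteger L) z =
      ∑ i, residue (normInteger k) (a i) • residue (normInteger L) (y i) := by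
    simp only [z, map_sum, Algebra.smul_def, map_mul, ResidueField.algebraMap_residue]
  rw [← hz, ← normInteger.residue_ne_zero_iff, hres]
  exact fun h => normInteger.residue_ne_zero_iff.mpr hj (Fintype.linearIndependent_iff.mp hy _ h j)

theorem norm_sum_smul_of_linearIndependent_residue {ι : Type*} [Fintype ι] {y : ι → normInteger L}
    (hy : LinearIndependent (ResidueField (normInteger k)) fun i => residue (normInteger L) (y i))
    {c : ι → k} {j : ι} (hj : ∀ i, ‖c i‖ ≤ ‖c j‖) : ‖∑ i, c i • (y i : L)‖ = ‖c j‖ := by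
  rcases eq_or_ne (c j) 0 with h0 | h0
  · have hc : ∀ i, c i = 0 := fun i => norm_le_zero_iff.mp (by simpa [h0] using hj i)
    simp [hc]
  have ha : ∀ i, (c j)⁻¹ * c i ∈ normInteger k := fun i => by
    rw [mem_normInteger, norm_mul, norm_inv]
    exact inv_mul_le_one_of_le₀ (hj i) (norm_nonneg _)
  have hunit := norm_sum_smul_eq_one_of_linearIndependent_residue hy (fun i => ⟨_, ha i⟩) (j := j)
    (by simp [h0])
  simp only [mul_smul, ← Finset.smul_sum] at hunit
  rw [norm_smul, norm_inv, inv_mul_eq_one₀ (norm_ne_zero_iff.mpr h0)] at hunit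
  exact hunit.symm

theorem linearIndependent_of_residue {ι : Type*} [Finite ι] {y : ι → normInteger L}
    (hy : LinearIndependent (ResidueField (normInteger k))
      fun i => residue (normInteger L) (y i)) : LinearIndependent k fun i => (y i : L) := by
  have := Fintype.ofFinite ι
  refine Fintype.linearIndependent_iff.mpr fun c hc i => ?_
  have : Nonempty ι := ⟨i⟩
  obtain ⟨j, hj⟩ := Finite.exists_max fun i => ‖c i‖
  have h := norm_sum_smul_of_linearIndependent_residue hy hj
  rw [hc, norm_zero] at h
  exact norm_le_zero_iff.mp ((hj i).trans h.symm.le)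

variable [FiniteDimensional k L]

theorem rank_residueField_le : Module.rank (ResidueField (normInteger k))
    (ResidueField (normInteger L)) ≤ (Module.finrank k L : ℕ) := by
  refine rank_le fun s hs => ?_
  choose y hy using fun x : s => residue_surjective (R := normInteger L) x
  have h : LinearIndependent k fun i => (y i : L) :=
    linearIndependent_of_residue (by simpa only [hy] using hs)
  simpa using h.fintype_card_le_finrank

instance finiteDimensional_residueField :
    FiniteDimensional (ResidueField (normInteger k)) (ResidueField (normInteger L)) :=
  Module.rank_lt_aleph0_iff.mp (rank_residueField_le.trans_lt Cardinal.natCast_lt_aleph0)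

theorem finrank_residueField_le : Module.finrank (ResidueField (normInteger k))
    (ResidueField (normInteger L)) ≤ Module.finrank k L :=
  Module.finrank_le_of_rank_le rank_residueField_le

theorem exists_norm_eq_of_finrank_residueField_eq
    (h : Module.finrank (ResidueField (normInteger k)) (ResidueField (normInteger L)) =
      Module.finrank k L) (x : L) : ∃ c : k, ‖x‖ = ‖c‖ := by
  let b := Module.finBasis (ResidueField (normInteger k)) (ResidueField (normInteger L))
  choose y hy using fun i => residue_surjective (R := normInteger L) (b i)
  have hy_indep : LinearIndependent (ResidueField (normInteger k))
      fun i => residue (normInteger L) (y i) := by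
    simpa only [hy] using b.linearIndependent
  have : Nonempty (Fin (Module.finrank (ResidueField (normInteger k))
    (ResidueField (normInteger L)))) := ⟨⟨0, Module.finrank_pos⟩⟩
  let B : Module.Basis _ k L := basisOfLinearIndependentOfCardEqFinrank
    (linearIndependent_of_residue hy_indep) (by simpa using h)
  have hB : ∑ i, B.repr x i • (y i : L) = x := by
    simpa only [B, coe_basisOfLinearIndependentOfCardEqFinrank] using B.sum_repr x
  obtain ⟨j, hj⟩ := Finite.exists_max fun i => ‖B.repr x i‖
  exact ⟨B.repr x j, by
    rw [← norm_sum_smul_of_linearIndependent_residue hy_indep hj, hB]⟩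

end Extension

section ResidueAut

variable {k L : Type*} [NontriviallyNormedField k] [IsUltrametricDist k] [CompleteSpace k]
  [NormedField L] [NormedAlgebra k L]

theorem norm_algEquiv_apply [Algebra.IsAlgebraic k L] (g : L ≃ₐ[k] L) (x : L) :
    ‖g x‖ = ‖x‖ := by
  rw [NormedAlgebra.norm_eq_spectralNorm k, NormedAlgebra.norm_eq_spectralNorm k,
    ← spectralNorm_eq_of_equiv g]

variable [IsUltrametricDist L]

/-- The action of an automorphism of `L` on the valuation ring. -/
def restrictNormInteger [Algebra.IsAlgebraic k L] (g : L ≃ₐ[k] L) :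
    normInteger L ≃ₐ[normInteger k] normInteger L where
  toFun x := ⟨g x, by
    rw [mem_normInteger, norm_algEquiv_apply]
    exact mem_normInteger.mp x.2⟩
  invFun x := ⟨g.symm x, by
    rw [mem_normInteger, norm_algEquiv_apply]
    exact mem_normInteger.mp x.2⟩
  left_inv x := Subtype.ext (g.symm_apply_apply x)
  right_inv x := Subtype.ext (g.apply_symm_apply x)
  map_add' x y := Subtype.ext (map_add g (x : L) y)
  map_mul' x y := Subtype.ext (map_mul g (x : L) y)
  commutes' c := Subtype.ext (g.commutes (c : k))

variable (k L) in
/-- The reduction homomorphism from the Galois group of `L / k` to that of its residue field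
extension. -/
noncomputable def residueAut [Algebra.IsAlgebraic k L] :
    (L ≃ₐ[k] L) →* (ResidueField (normInteger L) ≃ₐ[ResidueField (normInteger k)]
      ResidueField (normInteger L)) where
  toFun g := ResidueField.mapAlgEquiv' (restrictNormInteger g)
  map_one' := by
    ext x
    obtain ⟨x, rfl⟩ := residue_surjective x
    rfl
  map_mul' g h := by
    ext x
    obtain ⟨x, rfl⟩ := residue_surjective x
    rfl

theorem residueAut_residue [Algebra.IsAlgebraic k L] (g : L ≃ₐ[k] L) (x : normInteger L) :
    residueAut k L g (residue _ x) = residue _ (restrictNormInteger g x) :=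
  rfl

end ResidueAut

section Cyclotomic

theorem isPrimitiveRoot_map_of_natCast_ne_zero {R S : Type*} [CommRing R] [IsDomain R]
    [CommRing S] [IsDomain S] (f : R →+* S) {n : ℕ} (hn : (n : S) ≠ 0) {ζ : R}
    (hζ : IsPrimitiveRoot ζ n) : IsPrimitiveRoot (f ζ) n := by
  have : NeZero (n : S) := ⟨hn⟩
  have hpos : 0 < n := Nat.pos_of_ne_zero fun h => hn (by rw [h, Nat.cast_zero])
  rw [← Polynomial.isRoot_cyclotomic_iff, ← Polynomial.map_cyclotomic n f]
  exact (hζ.isRoot_cyclotomic hpos).map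

theorem natCast_card_pow_sub_one_ne_zero (κ l : Type*) [Field κ] [Finite κ] [Ring l]
    [Nontrivial l] [Algebra κ l] {r : ℕ} (hr : 0 < r) :
    ((Nat.card κ ^ r - 1 : ℕ) : l) ≠ 0 := by
  have := Fintype.ofFinite κ
  rw [Nat.cast_pred (pow_pos Nat.card_pos r), Nat.cast_pow, Nat.card_eq_fintype_card,
    ← map_natCast (algebraMap κ l), FiniteField.cast_card_eq_zero, map_zero, zero_pow hr.ne',
    zero_sub]
  exact neg_ne_zero.mpr one_ne_zero

theorem eq_of_map_eq_of_pow_eq_one {R S : Type*} [CommRing R] [IsDomain R] [CommRing S]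
    [IsDomain S] (f : R →+* S) {n : ℕ} (hn : (n : S) ≠ 0) {ζ : R} (hζ : IsPrimitiveRoot ζ n)
    {x y : R} (hx : x ^ n = 1) (hy : y ^ n = 1) (h : f x = f y) : x = y := by
  have : NeZero n := ⟨fun h => hn (by rw [h, Nat.cast_zero])⟩
  have hfζ := isPrimitiveRoot_map_of_natCast_ne_zero f hn hζ
  obtain ⟨i, -, rfl⟩ := hζ.eq_pow_of_pow_eq_one hx
  obtain ⟨j, -, rfl⟩ := hζ.eq_pow_of_pow_eq_one hy
  rw [map_pow, map_pow, (hfζ.isOfFinOrder (NeZero.ne n)).pow_eq_pow_iff_modEq,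
    ← hfζ.eq_orderOf] at h
  rwa [(hζ.isOfFinOrder (NeZero.ne n)).pow_eq_pow_iff_modEq, ← hζ.eq_orderOf]

theorem exists_isPrimitiveRoot_normInteger {L : Type*} [NormedField L] [IsUltrametricDist L]
    {n : ℕ} (hn : n ≠ 0) {ζ : L} (hζ : IsPrimitiveRoot ζ n) :
    ∃ ζ' : normInteger L, IsPrimitiveRoot ζ' n := by
  have hnorm : ‖ζ‖ = 1 := (pow_eq_one_iff_of_nonneg (norm_nonneg ζ) hn).mp
    (by rw [← norm_pow, hζ.pow_eq_one, norm_one])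
  exact ⟨⟨ζ, mem_normInteger.mpr hnorm.le⟩, IsPrimitiveRoot.coe_submonoidClass_iff.mp hζ⟩

variable {k L : Type*} [NontriviallyNormedField k] [IsUltrametricDist k] [CompleteSpace k]
  [NormedField L] [IsUltrametricDist L] [NormedAlgebra k L]

theorem eq_one_of_residueAut_apply_eq [Algebra.IsAlgebraic k L] {n : ℕ}
    [IsCyclotomicExtension {n} k L] (hn : (n : ResidueField (normInteger L)) ≠ 0)
    {ζ : normInteger L} (hζ : IsPrimitiveRoot ζ n) {g : L ≃ₐ[k] L}
    (hg : residueAut k L g (residue _ ζ) = residue _ ζ) : g = 1 := by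
  have : NeZero n := ⟨fun h => hn (by rw [h, Nat.cast_zero])⟩
  have hfix : restrictNormInteger g ζ = ζ :=
    eq_of_map_eq_of_pow_eq_one (residue _) hn hζ (by rw [← map_pow, hζ.pow_eq_one, map_one])
      hζ.pow_eq_one ((residueAut_residue g ζ).symm.trans hg)
  have hζL : IsPrimitiveRoot (ζ : L) n := IsPrimitiveRoot.coe_submonoidClass_iff.mpr hζ
  have hfixL : g ζ = ζ := congrArg Subtype.val hfix
  exact AlgEquiv.coe_toAlgHom_injective <| (hζL.powerBasis k).algHom_ext <| by simpa using hfixL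

theorem residueAut_injective [Algebra.IsAlgebraic k L] {n : ℕ}
    [IsCyclotomicExtension {n} k L] (hn : (n : ResidueField (normInteger L)) ≠ 0)
    {ζ : normInteger L} (hζ : IsPrimitiveRoot ζ n) : Function.Injective (residueAut k L) :=
  (injective_iff_map_eq_one _).mpr fun g hg =>
    eq_one_of_residueAut_apply_eq hn hζ (by rw [hg, AlgEquiv.one_apply])

variable [FiniteDimensional k L] [Finite (ResidueField (normInteger k))]

theorem residueAut_bijective [IsGalois k L] (h : Function.Injective (residueAut k L)) :
    Function.Bijective (residueAut k L) := by
  have : Finite (ResidueField (normInteger L)) :=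
    Module.finite_of_finite (ResidueField (normInteger k))
  refine h.bijective_of_nat_card_le ?_
  rw [IsGalois.card_aut_eq_finrank, IsGalois.card_aut_eq_finrank]
  exact finrank_residueField_le

theorem finrank_residueField_eq [IsGalois k L] (h : Function.Injective (residueAut k L)) :
    Module.finrank (ResidueField (normInteger k)) (ResidueField (normInteger L)) =
      Module.finrank k L := by
  have : Finite (ResidueField (normInteger L)) :=
    Module.finite_of_finite (ResidueField (normInteger k))
  rw [← IsGalois.card_aut_eq_finrank, ← IsGalois.card_aut_eq_finrank]
  exact (Nat.card_congr (Equiv.ofBijective _ (residueAut_bijective h))).symm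

theorem isCyclic_of_residueAut_injective (h : Function.Injective (residueAut k L)) :
    IsCyclic (L ≃ₐ[k] L) := by
  have : Finite (ResidueField (normInteger L)) :=
    Module.finite_of_finite (ResidueField (normInteger k))
  exact isCyclic_of_injective _ h

theorem le_finrank_of_isPrimitiveRoot {κ l : Type*} [Field κ] [Finite κ] [Field l] [Algebra κ l]
    [FiniteDimensional κ l] {r : ℕ} {ζ : l} (hζ : IsPrimitiveRoot ζ (Nat.card κ ^ r - 1)) :
    r ≤ Module.finrank κ l := by
  have : Finite l := Module.finite_of_finite κ
  have := Fintype.ofFinite l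
  have hcard : Nat.card l = Nat.card κ ^ Module.finrank κ l := Module.natCard_eq_pow_finrank
  rcases eq_or_ne r 0 with rfl | hr
  · exact Nat.zero_le _
  have hn : Nat.card κ ^ r - 1 ≠ 0 := (Nat.sub_pos_of_lt (Nat.one_lt_pow hr Finite.one_lt_card)).ne'
  have hdvd : Nat.card κ ^ r - 1 ∣ Nat.card l - 1 := hζ.dvd_of_pow_eq_one _ <| by
    rw [Nat.card_eq_fintype_card, FiniteField.pow_card_sub_one_eq_one _ (hζ.ne_zero hn)]
  have hle := Nat.le_of_dvd (Nat.sub_pos_of_lt Finite.one_lt_card) hdvd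
  have hone : 1 ≤ Nat.card l := Nat.card_pos
  refine (Nat.pow_le_pow_iff_right (Finite.one_lt_card (α := κ))).mp ?_
  rw [← hcard]
  omega

theorem finrank_dvd_of_frobenius_pow_eq_one {κ l : Type*} [Field κ] [Fintype κ] [Field l]
    [Algebra κ l] [FiniteDimensional κ l] {r : ℕ}
    (h : FiniteField.frobeniusAlgEquivOfAlgebraic κ l ^ r = 1) : Module.finrank κ l ∣ r := by
  have : Finite l := Module.finite_of_finite κ
  exact FiniteField.orderOf_frobeniusAlgEquivOfAlgebraic κ l ▸ orderOf_dvd_of_pow_eq_one h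

theorem finrank_residueField_of_isCyclotomicExtension [IsGalois k L] {r : ℕ} (hr : 0 < r)
    [IsCyclotomicExtension {Nat.card (ResidueField (normInteger k)) ^ r - 1} k L]
    {ζ : normInteger L}
    (hζ : IsPrimitiveRoot ζ (Nat.card (ResidueField (normInteger k)) ^ r - 1)) :
    Module.finrank (ResidueField (normInteger k)) (ResidueField (normInteger L)) = r := by
  have := Fintype.ofFinite (ResidueField (normInteger k))
  have hn := natCast_card_pow_sub_one_ne_zero (ResidueField (normInteger k))
    (ResidueField (normInteger L)) hr
  have hζ_res := isPrimitiveRoot_map_of_natCast_ne_zero (residue (normInteger L)) hn hζ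
  obtain ⟨σ, hσ⟩ := (residueAut_bijective (residueAut_injective (k := k) hn hζ)).2
    (FiniteField.frobeniusAlgEquivOfAlgebraic _ _)
  have hσr : σ ^ r = 1 := eq_one_of_residueAut_apply_eq hn hζ <| by
    rw [map_pow, hσ, AlgEquiv.coe_pow, FiniteField.coe_frobeniusAlgEquivOfAlgebraic_iterate,
      ← Nat.card_eq_fintype_card, ← Nat.sub_add_cancel (Nat.one_le_pow r _ Nat.card_pos)]
    beta_reduce
    rw [pow_succ, hζ_res.pow_eq_one, one_mul]
  refine le_antisymm (Nat.le_of_dvd hr (finrank_dvd_of_frobenius_pow_eq_one ?_))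
    (le_finrank_of_isPrimitiveRoot hζ_res)
  rw [← hσ, ← map_pow, hσr, map_one]

end Cyclotomic

theorem natCast_ne_zero_of_residue {k : Type*} [NormedField k] [IsUltrametricDist k] {n : ℕ}
    (hn : (n : ResidueField (normInteger k)) ≠ 0) : (n : k) ≠ 0 := fun h => hn <| by
  have hint : (n : normInteger k) = 0 := Subtype.ext (by push_cast; exact h)
  rw [← map_natCast (residue (normInteger k)), hint, map_zero]

theorem exists_unramified_cyclic_extension (k : Type u) [NontriviallyNormedField k]
    [IsUltrametricDist k] [CompleteSpace k] [Finite (ResidueField (normInteger k))] {r : ℕ}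
    (hr : 0 < r) :
    ∃ (L : Type u) (_ : NormedField L) (_ : NormedAlgebra k L),
      IsUltrametricDist L ∧ FiniteDimensional k L ∧ IsGalois k L ∧ IsCyclic (L ≃ₐ[k] L) ∧
      Module.finrank k L = r ∧ ∀ x : L, ∃ c : k, ‖x‖ = ‖c‖ := by
  have hone : 1 < Nat.card (ResidueField (normInteger k)) ^ r :=
    Nat.one_lt_pow hr.ne' Finite.one_lt_card
  set n := Nat.card (ResidueField (normInteger k)) ^ r - 1
  have : NeZero n := ⟨(Nat.sub_pos_of_lt hone).ne'⟩
  have : NeZero (n : k) :=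
    ⟨natCast_ne_zero_of_residue (natCast_card_pow_sub_one_ne_zero _ _ hr)⟩
  let L := CyclotomicField n k
  have : FiniteDimensional k L := IsCyclotomicExtension.finiteDimensional {n} k L
  have : IsGalois k L := IsCyclotomicExtension.isGalois {n} k L
  let : NormedField L := spectralNorm.normedField k L
  let : NormedAlgebra k L := spectralNorm.normedAlgebra k L
  have : IsUltrametricDist L := IsUltrametricDist.isUltrametricDist_of_isNonarchimedean_norm
    (isNonarchimedean_spectralNorm (K := k) (L := L))
  obtain ⟨ζ, hζ⟩ := exists_isPrimitiveRoot_normInteger (NeZero.ne n)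
    (IsCyclotomicExtension.zeta_spec n k L)
  have hinj : Function.Injective (residueAut k L) :=
    residueAut_injective (natCast_card_pow_sub_one_ne_zero _ _ hr) hζ
  have hdegree := finrank_residueField_eq hinj
  exact ⟨L, inferInstance, inferInstance, inferInstance, inferInstance, inferInstance,
    isCyclic_of_residueAut_injective hinj,
    hdegree.symm.trans (finrank_residueField_of_isCyclotomicExtension hr hζ),
    exists_norm_eq_of_finrank_residueField_eq hdegree⟩

end ResidueField

section DivisionAlgebra

variable {k L : Type u}

theorem exists_reducedNorm_cyclicAlgebra [Field k] [Field L] [Algebra k L] [FiniteDimensional k L]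
    [IsGalois k L] {σ : L ≃ₐ[k] L} (hgen : ∀ τ : L ≃ₐ[k] L, τ ∈ Subgroup.zpowers σ) {π : k}
    (hπ : π ≠ 0) (r : ℕ) [NeZero r] :
    ∃ nrd : cyclicAlgebra σ π r → k,
      ∀ a, algebraMap k L (nrd a) = (a : Matrix (Fin r) (Fin r) L).det :=
  Classical.skolem.mp fun a : cyclicAlgebra σ π r => exists_algebraMap_eq_of_generator hgen <|
    apply_det_of_mem_twistedCommutant (det_shiftMatrix_ne_zero (by simpa using hπ)) a.2

theorem exists_centralDivisionAlgebra_of_norm_det_eq [NormedField k] [NormedField L]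
    [NormedAlgebra k L] [IsUltrametricDist L] [FiniteDimensional k L] [IsGalois k L]
    {σ : L ≃ₐ[k] L} (hgen : ∀ τ : L ≃ₐ[k] L, τ ∈ Subgroup.zpowers σ) {π : k} (hπ : π ≠ 0)
    {r : ℕ} [NeZero r] (hdeg : Module.finrank k L = r) {ρ : ℝ} (hρ0 : 0 < ρ)
    (hdet : ∀ M ∈ cyclicAlgebra σ π r, ‖M.det‖ = weightedSupNorm ρ (M 0) ^ r) :
    ∃ (D : Type u) (_ : DivisionRing D) (_ : Algebra k D) (nrd : D → k),
      Algebra.IsCentral k D ∧ Module.finrank k D = r ^ 2 ∧ IsReducedNorm k D r nrd ∧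
      (∀ a, nrd a = 0 ↔ a = 0) ∧ ∀ a b, ‖nrd (a + b)‖ ≤ max ‖nrd a‖ ‖nrd b‖ := by
  have hord : orderOf σ = r := by
    rw [orderOf_eq_card_of_forall_mem_zpowers hgen, IsGalois.card_aut_eq_finrank, hdeg]
  let D := cyclicAlgebra σ π r
  have hdet_eq_zero : ∀ a : D, (a : Matrix (Fin r) (Fin r) L).det = 0 ↔ a = 0 := fun a =>
    (det_eq_zero_iff_of_norm_det_eq hπ hρ0 hdet a.2).trans (ZeroMemClass.coe_eq_zero (x := a))
  have : NoZeroDivisors D := ⟨fun {a b} hab => by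
    rw [← hdet_eq_zero, ← hdet_eq_zero, ← mul_eq_zero, ← Matrix.det_mul]
    exact (hdet_eq_zero _).mpr hab⟩
  have : IsDomain D := NoZeroDivisors.to_isDomain D
  have hdim : Module.finrank k D = r ^ 2 := by
    rw [finrank_cyclicAlgebra (hord ▸ pow_orderOf_eq_one σ) hπ, hdeg, sq]
  have hcentral : Algebra.IsCentral k D := isCentral_cyclicAlgebra hord hgen hπ
  let : DivisionRing D := divisionRingOfFiniteDimensional k D
  obtain ⟨nrd, hnrd⟩ := exists_reducedNorm_cyclicAlgebra hgen hπ r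
  have hnorm : ∀ a : D, ‖nrd a‖ = ‖(a : Matrix (Fin r) (Fin r) L).det‖ := fun a => by
    rw [← hnrd, norm_algebraMap']
  refine ⟨D, inferInstance, inferInstance, nrd, hcentral, hdim,
    isReducedNorm_of_algHom hdim (NeZero.pos r) D.val hnrd, fun a => ?_, fun a b => ?_⟩
  · rw [← map_eq_zero_iff _ (algebraMap k L).injective, hnrd]
    exact hdet_eq_zero a
  · rw [hnorm, hnorm, hnorm]
    exact norm_det_add_le_of_norm_det_eq hρ0 hdet a.2 b.2

theorem exists_centralDivisionAlgebra (k : Type u) [NontriviallyNormedField k]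
    [IsUltrametricDist k] [LocallyCompactSpace k] {r : ℕ} (hr : 0 < r) :
    ∃ (D : Type u) (_ : DivisionRing D) (_ : Algebra k D) (nrd : D → k),
      Algebra.IsCentral k D ∧ Module.finrank k D = r ^ 2 ∧ IsReducedNorm k D r nrd ∧
      (∀ a, nrd a = 0 ↔ a = 0) ∧ ∀ a b, ‖nrd (a + b)‖ ≤ max ‖nrd a‖ ‖nrd b‖ := by
  have : NeZero r := ⟨hr.ne'⟩
  have : ProperSpace k := ProperSpace.of_locallyCompactSpace k
  have := (normInteger.isDiscreteValuationRing_and_finite_residueField k).2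
  obtain ⟨L, _, _, _, _, _, _, hdeg, hnorm⟩ := exists_unramified_cyclic_extension k hr
  obtain ⟨σ, hgen⟩ := IsCyclic.exists_generator (α := L ≃ₐ[k] L)
  obtain ⟨π, hπ0, hπ1, hπval⟩ := exists_uniformizer k
  have hr0 : (r : ℝ) ≠ 0 := by exact_mod_cast hr.ne'
  let ρ : ℝ := ‖π‖ ^ ((1 : ℝ) / r)
  have hρ0 : 0 < ρ := Real.rpow_pos_of_pos (norm_pos_iff.mpr hπ0) _
  have hρ : ρ ^ r = ‖π‖ := by
    rw [← Real.rpow_natCast, ← Real.rpow_mul (norm_nonneg π), one_div_mul_cancel hr0,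
      Real.rpow_one]
  have hρ1 : ρ ≠ 1 := fun h => hπ1.ne (by rw [← hρ, h, one_pow])
  have hval : ∀ x : L, x ≠ 0 → ∃ m : ℤ, ‖x‖ = (ρ ^ r) ^ m := fun x hx => by
    obtain ⟨c, hc⟩ := hnorm x
    rw [hc, hρ]
    exact hπval c (norm_ne_zero_iff.mp (hc ▸ norm_ne_zero_iff.mpr hx))
  have hσr : σ ^ r = 1 := by
    rw [← hdeg, ← IsGalois.card_aut_eq_finrank]
    exact pow_card_eq_one'
  exact exists_centralDivisionAlgebra_of_norm_det_eq hgen hπ0 hdeg hρ0 fun M hM =>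
    norm_det_eq_weightedSupNorm_pow hσr (norm_algEquiv_apply σ) hρ0 hρ
      (fun _ _ _ _ hx h => eq_of_pow_mul_norm_eq hρ0 hρ1 hval hx h) hM

end DivisionAlgebra

theorem exists_injective_linearMap_of_finrank_le {k V W : Type*} [Field k] [AddCommGroup V]
    [Module k V] [FiniteDimensional k V] [AddCommGroup W] [Module k W] [FiniteDimensional k W]
    (h : Module.finrank k V ≤ Module.finrank k W) : ∃ ι : V →ₗ[k] W, Function.Injective ι := by
  rw [← lift_rank_le_iff_exists_linearMap, ← Module.finrank_eq_rank, ← Module.finrank_eq_rank,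
    Cardinal.lift_natCast, Cardinal.lift_natCast, Nat.cast_le]
  exact h

theorem proposition3p1_general :
    (∀ (V : Type v) [AddCommGroup V] [Module ℝ V] (Q : QuadraticForm ℝ V), Q.PosDef →
        IsVectorNorm ℝ (fun x : V => |Q x| ^ ((1 : ℝ) / 2))) ∧
    (∀ (k : Type u) [NontriviallyNormedField k] [IsUltrametricDist k] [LocallyCompactSpace k]
        (V : Type v) [AddCommGroup V] [Module k V] [FiniteDimensional k V]
        (r : ℕ), 0 < r → Module.finrank k V ≤ r ^ 2 →
        ∃ ν : V → k,
          IsHomogeneousPolynomialFunction k r ν ∧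
          (∀ x, ν x = 0 ↔ x = 0) ∧
          IsNonarchVectorNorm k (fun x : V => ‖ν x‖ ^ ((1 : ℝ) / (r : ℝ))) ∧
          ∃ (D : Type u) (_ : DivisionRing D) (_ : Algebra k D) (nrd : D → k) (ι : V →ₗ[k] D),
            Algebra.IsCentral k D ∧ Module.finrank k D = r ^ 2 ∧
            IsReducedNorm k D r nrd ∧ Function.Injective ι ∧ ∀ x, ν x = nrd (ι x)) := by
  refine ⟨fun V _ _ Q hQ => isVectorNorm_of_posDef hQ, fun k _ _ _ V _ _ _ r hr hV => ?_⟩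
  obtain ⟨D, _, _, nrd, hcentral, hdim, hnrd, hdef, hadd⟩ := exists_centralDivisionAlgebra k hr
  have : FiniteDimensional k D := Module.finite_of_finrank_pos (hdim ▸ pow_pos hr 2)
  obtain ⟨ι, hι⟩ := exists_injective_linearMap_of_finrank_le (hV.trans_eq hdim.symm)
  have hpoly : IsHomogeneousPolynomialFunction k r (nrd ∘ ι) :=
    hnrd.isHomogeneousPolynomialFunction_comp ι
  have hdefι : ∀ x, (nrd ∘ ι) x = 0 ↔ x = 0 := fun x => (hdef _).trans (map_eq_zero_iff ι hι)
  have haddι : ∀ x y, ‖(nrd ∘ ι) (x + y)‖ ≤ max ‖(nrd ∘ ι) x‖ ‖(nrd ∘ ι) y‖ := fun x y => by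
    simpa only [Function.comp_apply, map_add] using hadd (ι x) (ι y)
  exact ⟨nrd ∘ ι, hpoly, hdefι, hpoly.isNonarchVectorNorm hr hdefι haddι,
    D, inferInstance, inferInstance, nrd, ι, hcentral, hdim, hnrd, hι, fun _ => rfl⟩

theorem proposition3p1 :
    (∀ (V : Type v) [AddCommGroup V] [Module ℝ V] [FiniteDimensional ℝ V]
        (Q : QuadraticForm ℝ V), Q.PosDef →
        IsVectorNorm ℝ (fun x : V => |Q x| ^ ((1 : ℝ) / 2))) ∧
    (∀ (k : Type u) [NontriviallyNormedField k] [IsUltrametricDist k] [LocallyCompactSpace k]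
        (V : Type v) [AddCommGroup V] [Module k V] [FiniteDimensional k V]
        (r : ℕ), 0 < r → Module.finrank k V ≤ r ^ 2 →
        ∃ ν : V → k,
          IsHomogeneousPolynomialFunction k r ν ∧
          (∀ x, ν x = 0 ↔ x = 0) ∧
          IsNonarchVectorNorm k (fun x : V => ‖ν x‖ ^ ((1 : ℝ) / (r : ℝ))) ∧
          ∃ (D : Type u) (_ : DivisionRing D) (_ : Algebra k D) (nrd : D → k) (ι : V →ₗ[k] D),
            Algebra.IsCentral k D ∧ Module.finrank k D = r ^ 2 ∧
            IsReducedNorm k D r nrd ∧ Function.Injective ι ∧ ∀ x, ν x = nrd (ι x)) :=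
  ⟨fun V _ _ _ => (proposition3p1_general.{u, v}).1 V, proposition3p1_general.2⟩
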